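/- Let $q$ be a prime power, let $1\le k\le n$ be integers, and let $\gamma,\beta\in[0,1]$. For a real number $m$, a set $K\subseteq\mathbb{F}_q^n$ is called a $(k,m,\beta)$-Furstenberg set if, for at least a $\beta$-fraction of all $k$-dimensional linear subspaces $A\subseteq\mathbb{F}_q^n$, there exists $a\in\mathbb{F}_q^n$ such that $|(a+A)\cap K|\ge m$. Then every $(k,\gamma q^k,\beta)$-Furstenberg set $K\subseteq\mathbb{F}_q^n$ satisfies $$|K|\ \ge\ \beta\,\gamma^n q^n\left(1+\frac{1}{q^{k-1}}\right)^{-n}.$$ -/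

import Mathlib

open scoped Pointwise

/-- The set of directions of `k`-flats in `F ^ n`: all `k`-dimensional linear subspaces. -/
def directions (F : Type*) [Field F] (n k : ℕ) : Set (Submodule F (Fin n → F)) :=
  {A | Module.finrank F A = k}

/-- A set `R` (in applications a flat) is `m`-rich with respect to `S` if `|R ∩ S| ≥ m`. -/
def IsRich {F : Type*} {n : ℕ} (m : ℝ) (R S : Set (Fin n → F)) : Prop :=
  m ≤ ((R ∩ S).ncard : ℝ)

/-- `K` is a `(k, m, β)`-Furstenberg set: for at least a `β`-fraction of all `k`-dimensional
linear subspaces `A`, some translate `a + A` is `m`-rich with respect to `K`. -/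
def IsFurstenberg {F : Type*} [Field F] {n : ℕ} (k : ℕ) (m β : ℝ) (K : Set (Fin n → F)) : Prop :=
  β * ((directions F n k).ncard : ℝ) ≤
    ({A ∈ directions F n k | ∃ a : Fin n → F,
      IsRich m (a +ᵥ (A : Set (Fin n → F))) K}.ncard : ℝ)

/-! The proof is the polynomial method with multiplicities, run over the extension `L` of `F` of
degree `k`. For a `k`-dimensional subspace `A`, let `A_L` be its extension to `L`. Expanding
coordinates in an `F`-basis of `L` shows that every point of `L ^ n` lies in some `A_L`.

Let `P` have degree at most `d` and vanish to order `m` on `K`. If a translate of `A` is rich, the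
derivatives of `P` of order below `w` vanish on it by Schwartz–Zippel with multiplicities over the
grid `F ^ k`; hence the degree `d` part of `P` vanishes to order `w` on `A_L`
(`homogeneousComponent_mem_pointIdeal_pow`). Passing to leading forms bounds the dimension of all
such `P` by that of the space of polynomials vanishing to order `w` on `A_L` for every good
direction `A`.

When `d < q ^ k * w`, vanishing on all the `A_L` forces zero. Submodularity of codimension and
transitivity of the linear group on directions then give codimension at least `β` times the full
dimension for the good directions alone (`card_mul_finrank_add_le`). Vanishing on `K` costs at most
`|K|` times the number of monomials of degree below `m`. With `m` about `d / q ^ k + d / (γ * q)`,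
letting `d → ∞` gives `β ≤ |K| * (1 / q ^ k + 1 / (γ * q)) ^ n`. -/

namespace MvPolynomial

/-! ### Orders of vanishing as powers of ideals. -/

/-- The ideal of polynomials vanishing at the point `a`. -/
noncomputable def pointIdeal {σ R : Type*} [CommRing R] (a : σ → R) : Ideal (MvPolynomial σ R) :=
  Ideal.span (Set.range fun i => X i - C (a i))

/-- Reduces each transfer of multiplicity under a substitution to a check on the generators. -/
theorem map_mem_pow_of_mem_pointIdeal_pow {σ R S : Type*} [CommRing R] [CommRing S]
    (φ : MvPolynomial σ R →+* S) {a : σ → R} {I : Ideal S}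
    (h : ∀ i, φ (X i) - φ (C (a i)) ∈ I) {m : ℕ} {P : MvPolynomial σ R}
    (hP : P ∈ pointIdeal a ^ m) : φ P ∈ I ^ m := by
  have h1 : (pointIdeal a).map φ ≤ I := by
    rw [pointIdeal, Ideal.map_span, Ideal.span_le]
    rintro _ ⟨_, ⟨i, rfl⟩, rfl⟩
    simpa using h i
  have := Ideal.mem_map_of_mem φ hP
  rw [Ideal.map_pow] at this
  exact Ideal.pow_right_mono h1 m this

/-- The ideal of `R[X]` generated by the variables and by an ideal `I` of constants. -/
noncomputable def augmentedIdeal (σ : Type*) {R : Type*} [CommRing R] (I : Ideal R) :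
    Ideal (MvPolynomial σ R) :=
  idealOfVars σ R ⊔ I.map C

theorem coeff_mem_of_mem_augmentedIdeal {σ R : Type*} [CommRing R] {I : Ideal R}
    {g : MvPolynomial σ R} (hg : g ∈ augmentedIdeal σ I) (j : σ →₀ ℕ) :
    coeff j g ∈ I ^ (1 - j.degree) := by
  rcases eq_or_ne j 0 with rfl | hj
  · obtain ⟨u, hu, v, hv, rfl⟩ := Submodule.mem_sup.1 hg
    have h1 : coeff 0 u = 0 := by
      rw [← pow_one (idealOfVars σ R), mem_pow_idealOfVars_iff'] at hu
      exact hu 0 (by simp)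
    rw [mem_map_C_iff] at hv
    simpa [h1] using hv 0
  · have : 1 - j.degree = 0 := by
      have := mt (Finsupp.degree_eq_zero_iff j).1 hj
      omega
    simp [this]

/-- A characteristic-free form of the fact that a derivative of order `|j|` lowers the multiplicity
by at most `|j|`: Taylor coefficients replace derivatives. -/
theorem coeff_mem_of_mem_augmentedIdeal_pow {σ R : Type*} [CommRing R] {I : Ideal R} {m : ℕ}
    {g : MvPolynomial σ R} (hg : g ∈ augmentedIdeal σ I ^ m) (j : σ →₀ ℕ) :
    coeff j g ∈ I ^ (m - j.degree) := by
  classical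
  induction m generalizing g j with
  | zero => simp
  | succ m ih =>
    rw [pow_succ] at hg
    induction hg using Submodule.mul_induction_on' with
    | mem_mul_mem u hu v hv =>
      rw [coeff_mul]
      refine Ideal.sum_mem _ fun p hp => ?_
      have h1 := Ideal.mul_mem_mul (ih hu p.1) (coeff_mem_of_mem_augmentedIdeal hv p.2)
      rw [← pow_add] at h1
      refine Ideal.pow_le_pow_right ?_ h1
      rw [← Finset.HasAntidiagonal.mem_antidiagonal.1 hp, map_add]
      omega
    | add u _ v _ hu hv => rw [coeff_add]; exact Ideal.add_mem _ hu hv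

theorem C_mem_augmentedIdeal {σ R : Type*} [CommRing R] {I : Ideal R} {r : R} (hr : r ∈ I) :
    (C r : MvPolynomial σ R) ∈ augmentedIdeal σ I :=
  Ideal.mem_sup_right (Ideal.mem_map_of_mem C hr)

theorem X_mem_augmentedIdeal {σ R : Type*} [CommRing R] {I : Ideal R} (i : σ) :
    (X i : MvPolynomial σ R) ∈ augmentedIdeal σ I :=
  Ideal.mem_sup_left (Ideal.subset_span ⟨i, rfl⟩)

/-- The Taylor shift `P(X) ↦ P(X + a)`. -/
noncomputable def shift {σ R : Type*} [CommRing R] (a : σ → R) :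
    MvPolynomial σ R →ₐ[R] MvPolynomial σ R :=
  aeval fun i => X i + C (a i)

@[simp] theorem shift_X {σ R : Type*} [CommRing R] (a : σ → R) (i : σ) :
    shift a (X i) = X i + C (a i) := by simp [shift]

@[simp] theorem shift_C {σ R : Type*} [CommRing R] (a : σ → R) (r : R) :
    shift a (C r) = C r := by simp [shift]

theorem shift_neg_shift {σ R : Type*} [CommRing R] (a : σ → R) (P : MvPolynomial σ R) :
    shift (-a) (shift a P) = P := by
  have : (shift (-a)).comp (shift a) = AlgHom.id R _ := by
    ext i : 1
    simp
  exact DFunLike.congr_fun this P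

theorem mem_pointIdeal_pow_iff {σ R : Type*} [CommRing R] {a : σ → R} {m : ℕ}
    {P : MvPolynomial σ R} :
    P ∈ pointIdeal a ^ m ↔ ∀ j : σ →₀ ℕ, j.degree < m → coeff j (shift a P) = 0 := by
  rw [← mem_pow_idealOfVars_iff']
  constructor
  · intro h
    refine map_mem_pow_of_mem_pointIdeal_pow (shift a).toRingHom (fun i => ?_) h
    have : (X i : MvPolynomial σ R) ∈ idealOfVars σ R := Ideal.subset_span ⟨i, rfl⟩
    simpa using this
  · intro h
    have h0 : idealOfVars σ R = pointIdeal 0 := by simp [idealOfVars, pointIdeal]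
    rw [h0] at h
    have := map_mem_pow_of_mem_pointIdeal_pow (shift (-a)).toRingHom (I := pointIdeal a)
      (fun i => ?_) h
    · simpa [shift_neg_shift] using this
    · have h1 : X i - C (a i) ∈ pointIdeal a := Ideal.subset_span ⟨i, rfl⟩
      simpa [← sub_eq_add_neg] using h1

theorem shift_ne_zero {σ R : Type*} [CommRing R] (a : σ → R) {P : MvPolynomial σ R}
    (hP : P ≠ 0) : shift a P ≠ 0 := fun h => hP (by rw [← shift_neg_shift a P, h, map_zero])

/-- The order of vanishing of a nonzero polynomial is realised by a Taylor coefficient. -/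
theorem exists_order {σ R : Type*} [CommRing R] (a : σ → R) {P : MvPolynomial σ R}
    (hP : P ≠ 0) : ∃ j : σ →₀ ℕ, coeff j (shift a P) ≠ 0 ∧ P ∈ pointIdeal a ^ j.degree := by
  classical
  obtain ⟨j, hj, hmin⟩ := Finset.exists_min_image (shift a P).support Finsupp.degree
    (support_nonempty.2 (shift_ne_zero a hP))
  refine ⟨j, mem_support_iff.1 hj, mem_pointIdeal_pow_iff.2 fun i hi => ?_⟩
  by_contra h
  exact absurd (hmin i (mem_support_iff.2 h)) (by omega)

end MvPolynomial

/-! ### Schwartz–Zippel with multiplicities. -/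

theorem Polynomial.sum_multiplicity_le {L : Type*} [Field L] (S : Finset L) {c : Polynomial L}
    (hc : c ≠ 0) (e : L → ℕ)
    (he : ∀ z ∈ S, c ∈ Ideal.span {Polynomial.X - Polynomial.C z} ^ e z) :
    ∑ z ∈ S, e z ≤ c.natDegree := by
  have h1 : ∏ z ∈ S, (Polynomial.X - Polynomial.C z) ^ e z ∣ c := by
    refine Finset.prod_dvd_of_coprime (fun x _ y _ hxy => ?_) fun z hz => ?_
    · exact IsCoprime.pow (Polynomial.pairwise_coprime_X_sub_C Function.injective_id hxy)
    · have := he z hz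
      rwa [Ideal.span_singleton_pow, Ideal.mem_span_singleton] at this
  have h2 := Polynomial.natDegree_le_of_dvd h1 hc
  rw [Polynomial.natDegree_prod_of_monic _ _
    fun z _ => (Polynomial.monic_X_sub_C z).pow _] at h2
  simpa using h2

namespace MvPolynomial

/-- The Taylor expansion at `a` of the coefficients of a polynomial in one further variable. -/
noncomputable def shiftCoeffs {σ R : Type*} [CommRing R] (a : σ → R) :
    Polynomial (MvPolynomial σ R) →+* MvPolynomial σ (Polynomial R) :=
  Polynomial.eval₂RingHom ((map Polynomial.C).comp (shift a).toRingHom) (C Polynomial.X)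

theorem coeff_coeff_shiftCoeffs {σ R : Type*} [CommRing R] (a : σ → R)
    (G : Polynomial (MvPolynomial σ R)) (j : σ →₀ ℕ) (s : ℕ) :
    (coeff j (shiftCoeffs a G)).coeff s = coeff j (shift a (G.coeff s)) := by
  induction G using Polynomial.induction_on' with
  | add p q hp hq => simp [hp, hq]
  | monomial k r =>
    simp only [shiftCoeffs, Polynomial.coe_eval₂RingHom, Polynomial.eval₂_monomial, ← C_pow,
      Polynomial.coeff_monomial]
    rw [mul_comm, coeff_C_mul]
    simp only [RingHom.comp_apply, coeff_map, AlgHom.toRingHom_eq_coe, RingHom.coe_coe]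
    rw [mul_comm, Polynomial.coeff_C_mul, Polynomial.coeff_X_pow]
    by_cases h : s = k
    · simp [h]
    · simp [h, Ne.symm h]

theorem coeff_shiftCoeffs_mem {R : Type*} [CommRing R] {n : ℕ} {a : Fin n → R} {z : R} {m : ℕ}
    {P : MvPolynomial (Fin (n + 1)) R}
    (hP : P ∈ pointIdeal (Fin.cons z a : Fin (n + 1) → R) ^ m) (j : Fin n →₀ ℕ) :
    coeff j (shiftCoeffs a (finSuccEquiv R n P)) ∈
      Ideal.span {Polynomial.X - Polynomial.C z} ^ (m - j.degree) := by
  refine coeff_mem_of_mem_augmentedIdeal_pow (map_mem_pow_of_mem_pointIdeal_pow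
    ((shiftCoeffs a).comp (finSuccEquiv R n).toRingEquiv.toRingHom) (fun i => ?_) hP) j
  have hC : ∀ r : R, finSuccEquiv R n (C r) = Polynomial.C (C r) := fun r => by
    simp [finSuccEquiv_apply]
  refine Fin.cases ?_ (fun i => ?_) i
  · have : (C (Polynomial.X - Polynomial.C z) : MvPolynomial (Fin n) (Polynomial R)) ∈
        augmentedIdeal (Fin n) (Ideal.span {Polynomial.X - Polynomial.C z}) :=
      C_mem_augmentedIdeal (Ideal.subset_span rfl)
    simpa [shiftCoeffs, hC, finSuccEquiv_X_zero] using this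
  · have := X_mem_augmentedIdeal (I := Ideal.span {Polynomial.X - Polynomial.C z}) i
    simpa [shiftCoeffs, hC, finSuccEquiv_X_succ] using this

/-- The Schwartz–Zippel lemma with multiplicities. -/
theorem card_mul_sum_multiplicity_le {L : Type*} [Field L] (S : Finset L) {n d : ℕ}
    {P : MvPolynomial (Fin n) L} (hP : P ≠ 0) (hd : P.totalDegree ≤ d) (l : (Fin n → L) → ℕ)
    (hl : ∀ p ∈ Fintype.piFinset fun _ => S, P ∈ pointIdeal p ^ l p) :
    S.card * ∑ p ∈ Fintype.piFinset fun _ => S, l p ≤ d * S.card ^ n := by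
  induction n generalizing d with
  | zero =>
    -- Without variables the point ideal is zero, so a nonzero `P` has multiplicity 0.
    have h0 : ∀ p ∈ Fintype.piFinset fun _ : Fin 0 => S, l p = 0 := by
      intro p hp
      by_contra h
      have hI : (pointIdeal p : Ideal (MvPolynomial (Fin 0) L)) = ⊥ := by
        simp [pointIdeal]
      have := hl p hp
      rw [hI, ← Ideal.zero_eq_bot, zero_pow h] at this
      exact hP (by simpa using this)
    rw [Finset.sum_eq_zero h0]
    simp
  | succ n ih =>
    set G := finSuccEquiv L n P with hG
    have hG0 : G ≠ 0 := by simpa [hG] using hP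
    set t := G.natDegree with ht
    have hPt : G.coeff t ≠ 0 := by simpa [ht] using hG0
    have hdeg : (G.coeff t).totalDegree + t ≤ P.totalDegree :=
      totalDegree_coeff_finSuccEquiv_add_le P t hPt
    -- `j a` realises the order at `a` of the leading coefficient in the first variable. The Taylor
    -- coefficient of `P` at `j a` is then a nonzero univariate polynomial of degree at most `t`, to
    -- which root counting applies.
    choose j hj hjm using fun a : Fin n → L => exists_order a hPt
    have h1 := ih hPt (d := d - t) (by omega) (fun a => (j a).degree) fun a _ => hjm a
    have h2 : ∀ a ∈ Fintype.piFinset fun _ : Fin n => S,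
        ∑ z ∈ S, l (Fin.cons z a) ≤ S.card * (j a).degree + t := by
      intro a ha
      have hc : coeff (j a) (shiftCoeffs a G) ≠ 0 := by
        intro h
        apply hj a
        rw [← coeff_coeff_shiftCoeffs, h, Polynomial.coeff_zero]
      have h3 := Polynomial.sum_multiplicity_le S hc
        (fun z => l (Fin.cons z a) - (j a).degree) fun z hz =>
          coeff_shiftCoeffs_mem (hl _ (by
            rw [Fintype.mem_piFinset] at ha ⊢
            exact Fin.cases hz ha)) (j a)
      have h4 : (coeff (j a) (shiftCoeffs a G)).natDegree ≤ t := by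
        rw [Polynomial.natDegree_le_iff_coeff_eq_zero]
        intro N hN
        rw [coeff_coeff_shiftCoeffs, Polynomial.coeff_eq_zero_of_natDegree_lt hN]
        simp
      calc ∑ z ∈ S, l (Fin.cons z a)
          ≤ ∑ z ∈ S, ((j a).degree + (l (Fin.cons z a) - (j a).degree)) :=
            Finset.sum_le_sum fun z _ => by omega
        _ = S.card * (j a).degree + ∑ z ∈ S, (l (Fin.cons z a) - (j a).degree) := by
            rw [Finset.sum_add_distrib, Finset.sum_const, smul_eq_mul]
        _ ≤ _ := by omega
    have h5 : ∑ p ∈ Fintype.piFinset fun _ : Fin (n + 1) => S, l p =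
        ∑ a ∈ Fintype.piFinset fun _ : Fin n => S, ∑ z ∈ S, l (Fin.cons z a) := by
      rw [← Finset.sum_product']
      refine Finset.sum_nbij' (fun p => (Fin.tail p, p 0)) (fun x => Fin.cons x.2 x.1)
        ?_ ?_ ?_ ?_ ?_
      · intro p hp
        rw [Fintype.mem_piFinset] at hp
        simp [Fin.tail, hp]
      · intro x hx
        rw [Finset.mem_product, Fintype.mem_piFinset] at hx
        rw [Fintype.mem_piFinset]
        exact Fin.cases hx.2 hx.1
      · simp
      · simp
      · simp
    have h6 := Finset.sum_le_sum h2
    rw [Finset.sum_add_distrib, ← Finset.mul_sum, Finset.sum_const, smul_eq_mul,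
      Fintype.card_piFinset_const] at h6
    rw [h5]
    have hdt : d = (d - t) + t := by omega
    calc _ ≤ S.card * (S.card * ∑ a ∈ Fintype.piFinset fun _ : Fin n => S, (j a).degree
          + S.card ^ n * t) := Nat.mul_le_mul_left _ h6
      _ ≤ S.card * ((d - t) * S.card ^ n + S.card ^ n * t) := by gcongr
      _ = ((d - t) + t) * S.card ^ (n + 1) := by ring
      _ = _ := by rw [← hdt]

/-- A polynomial vanishing to order `w` on a subset `T` of a grid is zero if `w|T|` is large. -/
theorem eq_zero_of_mem_pointIdeal_pow {L : Type*} [Field L] (S : Finset L) {n d w : ℕ}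
    {P : MvPolynomial (Fin n) L} (hd : P.totalDegree ≤ d) (T : Finset (Fin n → L))
    (hTS : T ⊆ Fintype.piFinset fun _ => S) (hT : ∀ p ∈ T, P ∈ pointIdeal p ^ w)
    (h : d * S.card ^ n < S.card * (T.card * w)) : P = 0 := by
  classical
  by_contra hP
  have h1 := card_mul_sum_multiplicity_le S hP hd (fun p => if p ∈ T then w else 0)
    fun p _ => by
      split_ifs with hp
      · exact hT p hp
      · simp
  rw [← Finset.sum_filter, Finset.filter_mem_eq_inter, Finset.inter_eq_right.2 hTS,
    Finset.sum_const, smul_eq_mul] at h1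
  omega

end MvPolynomial

/-! ### Restriction to flats and leading forms. -/

namespace Polynomial

theorem coeff_prod_pow_of_natDegree_le_one {ι A : Type*} [CommRing A] (f : ι → Polynomial A)
    (hf : ∀ i, (f i).natDegree ≤ 1) (m : ι → ℕ) (T : Finset ι) :
    (∏ i ∈ T, f i ^ m i).natDegree ≤ ∑ i ∈ T, m i ∧
      (∏ i ∈ T, f i ^ m i).coeff (∑ i ∈ T, m i) = ∏ i ∈ T, (f i).coeff 1 ^ m i := by
  classical
  have hp : ∀ i, (f i ^ m i).natDegree ≤ m i := fun i => by
    simpa using natDegree_pow_le_of_le (m i) (hf i)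
  have hc : ∀ i, (f i ^ m i).coeff (m i) = (f i).coeff 1 ^ m i := fun i => by
    simpa using coeff_pow_of_natDegree_le (m := m i) (hf i)
  induction T using Finset.induction_on with
  | empty => simp
  | insert i T hi ih =>
    rw [Finset.prod_insert hi, Finset.sum_insert hi, Finset.prod_insert hi]
    refine ⟨natDegree_mul_le_of_le (hp i) ih.1, ?_⟩
    rw [coeff_mul_add_eq_of_natDegree_le (hp i) ih.1, hc, ih.2]

end Polynomial

namespace MvPolynomial

/-- The substitution `X ↦ s (X + x) + a`, as a polynomial in `s`. -/
noncomputable def dilate {σ L : Type*} [CommRing L] (x a : σ → L) :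
    MvPolynomial σ L →ₐ[L] Polynomial (MvPolynomial σ L) :=
  aeval fun i => Polynomial.X * Polynomial.C (X i + C (x i)) + Polynomial.C (C (a i))

/-- Only monomials of degree exactly `d` reach `s ^ d`, and only by taking the `s` term from every
factor, so the translation `a` disappears. -/
theorem coeff_dilate {σ L : Type*} [CommRing L] (x a : σ → L) {d : ℕ} {P : MvPolynomial σ L}
    (hd : P.totalDegree ≤ d) :
    (dilate x a P).coeff d = shift x (homogeneousComponent d P) := by
  classical
  have key : ∀ m ∈ P.support, ∀ r : L, (dilate x a (monomial m r)).coeff d =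
      shift x (homogeneousComponent d (monomial m r)) := by
    intro m hm r
    have hmd : m.degree ≤ d := (le_totalDegree hm).trans hd
    set f : σ → Polynomial (MvPolynomial σ L) := fun i =>
      Polynomial.X * Polynomial.C (X i + C (x i)) + Polynomial.C (C (a i)) with hf
    have hf1 : ∀ i, (f i).natDegree ≤ 1 := fun i => by
      simp only [hf]
      compute_degree
    have hf2 : ∀ i, (f i).coeff 1 = X i + C (x i) := fun i => by
      simp [hf, Polynomial.coeff_C]
    obtain ⟨h1, h2⟩ := Polynomial.coeff_prod_pow_of_natDegree_le_one f hf1 m m.support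
    have h3 : dilate x a (monomial m r) =
        Polynomial.C (C r) * ∏ i ∈ m.support, f i ^ m i := by
      rw [dilate, aeval_monomial]
      rfl
    rw [h3, Polynomial.coeff_C_mul]
    rcases hmd.eq_or_lt with rfl | hlt
    · have h4 : homogeneousComponent m.degree (monomial m r) = monomial m r := by
        rw [homogeneousComponent_of_mem (isHomogeneous_monomial r rfl), if_pos rfl]
      rw [h4, shift, aeval_monomial]
      change _ * Polynomial.coeff _ (∑ i ∈ m.support, m i) = _
      rw [h2]
      simp only [hf2]
      rfl
    · have h4 : homogeneousComponent d (monomial m r) = 0 := by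
        rw [homogeneousComponent_of_mem (isHomogeneous_monomial r rfl), if_neg hlt.ne']
      rw [h4, map_zero, Polynomial.coeff_eq_zero_of_natDegree_lt (h1.trans_lt hlt), mul_zero]
  conv_lhs => rw [P.as_sum]
  conv_rhs => rw [P.as_sum]
  simp only [map_sum, Polynomial.finsetSum_coeff]
  exact Finset.sum_congr rfl fun m hm => key m hm _

/-- The restriction of a polynomial and its derivatives to the flat through `a` with directions
`b`: the substitution `X ↦ Y + a + ∑ t, X t • b t`. -/
noncomputable def flatExpand {σ κ L : Type*} [CommRing L] [Fintype κ] (a : σ → L)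
    (b : κ → σ → L) : MvPolynomial σ L →+* MvPolynomial σ (MvPolynomial κ L) :=
  eval₂Hom (C.comp C) fun i => X i + C (C (a i) + ∑ t, X t * C (b t i))

theorem totalDegree_coeff_flatExpand_le {σ κ L : Type*} [CommRing L] [Fintype κ] (a : σ → L)
    (b : κ → σ → L) {P : MvPolynomial σ L} {d : ℕ} (hd : P.totalDegree ≤ d) (j : σ →₀ ℕ) :
    (coeff j (flatExpand a b P)).totalDegree ≤ d := by
  classical
  have hmul : ∀ {d e : ℕ} {u v : MvPolynomial σ (MvPolynomial κ L)},
      (∀ j, (coeff j u).totalDegree ≤ d) → (∀ j, (coeff j v).totalDegree ≤ e) →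
      ∀ j, (coeff j (u * v)).totalDegree ≤ d + e := by
    intro d e u v hu hv j
    rw [coeff_mul]
    refine (totalDegree_finsetSum_le fun p _ => ?_)
    exact (totalDegree_mul _ _).trans (add_le_add (hu _) (hv _))
  have hpow : ∀ {u : MvPolynomial σ (MvPolynomial κ L)}, (∀ j, (coeff j u).totalDegree ≤ 1) →
      ∀ e j, (coeff j (u ^ e)).totalDegree ≤ e := by
    intro u hu e
    induction e with
    | zero =>
      intro j
      rw [pow_zero, coeff_one]
      split_ifs <;> simp
    | succ e ih => rw [pow_succ]; exact hmul ih hu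
  have hX : ∀ i j, (coeff j (X i + C (C (a i) + ∑ t, X t * C (b t i)) :
      MvPolynomial σ (MvPolynomial κ L))).totalDegree ≤ 1 := by
    intro i j
    rw [coeff_add]
    refine (totalDegree_add _ _).trans (max_le ?_ ?_)
    · rw [coeff_X]
      split_ifs <;> simp
    · rw [coeff_C]
      split_ifs
      · refine (totalDegree_add _ _).trans (max_le (by simp) ?_)
        refine totalDegree_finsetSum_le fun t _ => (totalDegree_mul _ _).trans ?_
        rw [totalDegree_C, add_zero]
        exact totalDegree_monomial_le _ _ |>.trans (by simp)
      · simp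
  have hprod : ∀ (m : σ →₀ ℕ) (T : Finset σ) (j : σ →₀ ℕ),
      (coeff j (∏ i ∈ T, (X i + C (C (a i) + ∑ t, X t * C (b t i)) :
        MvPolynomial σ (MvPolynomial κ L)) ^ m i)).totalDegree ≤ ∑ i ∈ T, m i := by
    intro m T
    induction T using Finset.induction_on with
    | empty =>
      intro j
      rw [Finset.prod_empty, coeff_one]
      split_ifs <;> simp
    | insert i T hi ih =>
      rw [Finset.prod_insert hi, Finset.sum_insert hi]
      exact hmul (hpow (hX i) _) ih
  rw [flatExpand, coe_eval₂Hom, eval₂_eq, coeff_sum]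
  refine totalDegree_finsetSum_le fun m hm => ?_
  rw [RingHom.comp_apply, coeff_C_mul]
  refine (totalDegree_mul _ _).trans ?_
  rw [totalDegree_C, zero_add]
  exact (hprod m m.support j).trans ((le_totalDegree hm).trans hd)

theorem coeff_flatExpand_mem {σ κ L : Type*} [CommRing L] [Fintype κ] {a : σ → L}
    {b : κ → σ → L} {p : κ → L} {m : ℕ} {P : MvPolynomial σ L}
    (hP : P ∈ pointIdeal (fun i => a i + ∑ t, p t * b t i) ^ m) (j : σ →₀ ℕ) :
    coeff j (flatExpand a b P) ∈ pointIdeal p ^ (m - j.degree) := by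
  refine coeff_mem_of_mem_augmentedIdeal_pow (map_mem_pow_of_mem_pointIdeal_pow
    (flatExpand a b) (fun i => ?_) hP) j
  -- The generator at the point with parameters `p` maps to `X i` plus this sum, an element of the
  -- augmented ideal.
  have h1 : (∑ t, (X t - C (p t)) * C (b t i)) ∈ pointIdeal p :=
    Ideal.sum_mem _ fun t _ => Ideal.mul_mem_right _ _ (Ideal.subset_span ⟨t, rfl⟩)
  have h2 := Ideal.add_mem _ (X_mem_augmentedIdeal (I := pointIdeal p) i)
    (C_mem_augmentedIdeal (σ := σ) h1)
  convert h2 using 1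
  simp only [flatExpand, coe_eval₂Hom, eval₂_X, eval₂_C, RingHom.comp_apply, map_add, map_sum,
    map_mul, sub_mul, Finset.sum_sub_distrib, map_sub]
  ring

/-- Substituting `s * Y` for `Y` and `s * c t` for the flat parameters turns the flat expansion into
the dilation, and sends `(Y) ^ w` into itself coefficientwise in `s`. -/
theorem dilate_mem_of_flatExpand_mem {σ κ L : Type*} [CommRing L] [Fintype κ] {a : σ → L}
    {b : κ → σ → L} (c : κ → L) {w : ℕ} {P : MvPolynomial σ L}
    (hP : flatExpand a b P ∈ idealOfVars σ (MvPolynomial κ L) ^ w) (d : ℕ) :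
    (dilate (fun i => ∑ t, c t * b t i) a P).coeff d ∈ idealOfVars σ L ^ w := by
  let ξ : MvPolynomial σ (MvPolynomial κ L) →+* Polynomial (MvPolynomial σ L) :=
    eval₂Hom (eval₂Hom (Polynomial.C.comp C) fun t => Polynomial.X * Polynomial.C (C (c t)))
      fun i => Polynomial.X * Polynomial.C (X i)
  have h0 : idealOfVars σ (MvPolynomial κ L) = pointIdeal 0 := by simp [idealOfVars, pointIdeal]
  rw [h0] at hP
  have h1 := map_mem_pow_of_mem_pointIdeal_pow ξ (I := (idealOfVars σ L).map Polynomial.C)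
    (fun i => ?_) hP
  · have h2 : (ξ.comp (flatExpand a b)) =
        (dilate (fun i => ∑ t, c t * b t i) a : MvPolynomial σ L →+* _) := by
      ext i : 2
      · ext r : 1
        simp only [ξ, flatExpand, dilate, RingHom.comp_apply, coe_eval₂Hom, eval₂_C,
          RingHom.coe_coe, algHom_C]
        rfl
      · simp only [ξ, flatExpand, dilate, RingHom.comp_apply, coe_eval₂Hom, eval₂_C, eval₂_X,
          RingHom.coe_coe, aeval_X, map_add, map_sum, map_mul, Finset.mul_sum, mul_add]
        ring_nf
    have h3 := RingHom.congr_fun h2 P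
    rw [RingHom.comp_apply] at h3
    rw [h3, ← Ideal.map_pow, Ideal.mem_map_C_iff] at h1
    exact h1 d
  · have : (X i : MvPolynomial σ L) ∈ idealOfVars σ L := Ideal.subset_span ⟨i, rfl⟩
    have h2 : ξ (X i) - ξ (C ((0 : σ → MvPolynomial κ L) i)) =
        Polynomial.X * Polynomial.C (X i) := by
      rw [Pi.zero_apply, map_zero, map_zero, sub_zero]
      exact eval₂Hom_X' _ _ i
    rw [h2]
    exact Ideal.mul_mem_left _ _ (Ideal.mem_map_of_mem _ this)

/-- If `P` has degree at most `d` and vanishes to high order at many points of the flat through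
`a` with directions `b`, then its degree `d` part vanishes to order `w` on the linear span
of `b`. -/
theorem homogeneousComponent_mem_pointIdeal_pow {σ L : Type*} [Field L] {k : ℕ} {a : σ → L}
    {b : Fin k → σ → L} {d m w : ℕ} {P : MvPolynomial σ L} (hd : P.totalDegree ≤ d)
    (S : Finset L) (T : Finset (Fin k → L)) (hTS : T ⊆ Fintype.piFinset fun _ => S)
    (hT : ∀ p ∈ T, P ∈ pointIdeal (fun i => a i + ∑ t, p t * b t i) ^ m)
    (h : d * S.card ^ k < S.card * (T.card * (m - w))) (c : Fin k → L) :
    homogeneousComponent d P ∈ pointIdeal (fun i => ∑ t, c t * b t i) ^ w := by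
  have h1 : flatExpand a b P ∈ idealOfVars σ (MvPolynomial (Fin k) L) ^ w := by
    rw [mem_pow_idealOfVars_iff']
    intro j hj
    -- For `|j| < w` the coefficient still vanishes to order `m - |j| ≥ m - w` on `T`, too often for
    -- its degree.
    refine eq_zero_of_mem_pointIdeal_pow S (totalDegree_coeff_flatExpand_le a b hd j) T hTS
      (fun p hp => coeff_flatExpand_mem (hT p hp) j) (h.trans_le ?_)
    gcongr
  have h2 := dilate_mem_of_flatExpand_mem c h1 d
  rw [coeff_dilate _ _ hd] at h2
  exact mem_pointIdeal_pow_iff.2 ((mem_pow_idealOfVars_iff' _ _).1 h2)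

end MvPolynomial

/-! ### Dimension counts. -/

/-- The exponents of the monomials of degree less than `D` in `n` variables. -/
def exponentsBelow (n D : ℕ) : Finset (Fin n →₀ ℕ) :=
  (Finset.range D).biUnion fun d => Finset.finsuppAntidiag Finset.univ d

theorem mem_exponentsBelow {n D : ℕ} {j : Fin n →₀ ℕ} :
    j ∈ exponentsBelow n D ↔ j.degree < D := by
  simp [exponentsBelow, Finset.mem_finsuppAntidiag, Finsupp.degree_eq_sum]

theorem factorial_mul_card_exponentsBelow (n D : ℕ) :
    n.factorial * (exponentsBelow n (D + 1)).card = (D + 1).ascFactorial n := by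
  have h1 : ∀ D, ∑ d ∈ Finset.range (D + 1), n.multichoose d = (n + 1).multichoose D := by
    intro D
    induction D with
    | zero => simp
    | succ D ih => rw [Finset.sum_range_succ, ih, Nat.multichoose_succ_succ, add_comm]
  rw [exponentsBelow, Finset.card_biUnion]
  · simp only [Finset.card_finsuppAntidiag_nat_eq_multichoose, Finset.card_univ,
      Fintype.card_fin]
    rw [h1, Nat.multichoose_eq, Nat.ascFactorial_eq_factorial_mul_choose]
    congr 1
    rw [show n + 1 + D - 1 = D + n by omega]
    exact (Nat.choose_symm_add).trans rfl
  · intro d _ e _ hde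
    rw [Function.onFun, Finset.disjoint_left]
    intro j hj hj'
    rw [Finset.mem_finsuppAntidiag] at hj hj'
    exact hde (hj.1.symm.trans hj'.1)

theorem Submodule.finrank_map_add_finrank_inf_ker {K M M' : Type*} [Field K] [AddCommGroup M]
    [Module K M] [AddCommGroup M'] [Module K M'] (f : M →ₗ[K] M') (V : Submodule K M)
    [FiniteDimensional K V] :
    Module.finrank K (V.map f) + Module.finrank K (V ⊓ LinearMap.ker f : Submodule K M) =
      Module.finrank K V := by
  have h := (f.domRestrict V).finrank_range_add_finrank_ker
  rw [LinearMap.range_domRestrict, LinearMap.ker_domRestrict] at h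
  rw [← h, ← Submodule.map_comap_subtype,
    (Submodule.equivMapOfInjective V.subtype V.injective_subtype _).finrank_eq]

namespace MvPolynomial

/-- Polynomials in `n` variables of degree less than `D`. -/
noncomputable def degreeBelow (L : Type*) [Field L] (n D : ℕ) :
    Submodule L (MvPolynomial (Fin n) L) :=
  restrictSupport L (exponentsBelow n D : Set (Fin n →₀ ℕ))

theorem mem_degreeBelow {L : Type*} [Field L] {n D : ℕ} {P : MvPolynomial (Fin n) L} :
    P ∈ degreeBelow L n D ↔ ∀ j ∈ P.support, j.degree < D := by
  simp only [degreeBelow, mem_restrictSupport_iff, Set.subset_def, Finset.mem_coe,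
    mem_exponentsBelow]

theorem mem_degreeBelow_succ {L : Type*} [Field L] {n D : ℕ} {P : MvPolynomial (Fin n) L} :
    P ∈ degreeBelow L n (D + 1) ↔ P.totalDegree ≤ D := by
  rw [mem_degreeBelow]
  constructor
  · intro h
    exact Finset.sup_le fun j hj => Nat.lt_succ_iff.1 (h j hj)
  · intro h j hj
    exact Nat.lt_succ_iff.2 ((le_totalDegree hj).trans h)

instance {L : Type*} [Field L] (n D : ℕ) : FiniteDimensional L (degreeBelow L n D) :=
  Module.Finite.of_basis (basisRestrictSupport L _)

theorem finrank_degreeBelow (L : Type*) [Field L] (n D : ℕ) :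
    Module.finrank L (degreeBelow L n D) = (exponentsBelow n D).card := by
  unfold degreeBelow
  rw [Module.finrank_eq_nat_card_basis (basisRestrictSupport L _)]
  simp

/-- Polynomials vanishing to order `m` at every point of `Z`. -/
noncomputable def vanishing {σ L : Type*} [Field L] (Z : Set (σ → L)) (m : ℕ) :
    Submodule L (MvPolynomial σ L) :=
  (⨅ a ∈ Z, pointIdeal a ^ m).restrictScalars L

theorem mem_vanishing {σ L : Type*} [Field L] {Z : Set (σ → L)} {m : ℕ}
    {P : MvPolynomial σ L} : P ∈ vanishing Z m ↔ ∀ a ∈ Z, P ∈ pointIdeal a ^ m := by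
  simp [vanishing, Submodule.mem_iInf]

/-- Vanishing to order `m` at one point is one linear condition per Taylor coefficient of degree
below `m`. -/
theorem finrank_degreeBelow_le {L : Type*} [Field L] {n : ℕ} (Z : Finset (Fin n → L))
    (m D : ℕ) : (exponentsBelow n D).card ≤
      Module.finrank L (degreeBelow L n D ⊓ vanishing (Z : Set (Fin n → L)) m : Submodule L _) +
        Z.card * (exponentsBelow n m).card := by
  let f : MvPolynomial (Fin n) L →ₗ[L] (Z × exponentsBelow n m → L) :=
    LinearMap.pi fun x => (lcoeff L x.2.1).comp (shift x.1.1).toLinearMap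
  have hf : LinearMap.ker f = vanishing (Z : Set (Fin n → L)) m := by
    ext P
    rw [LinearMap.mem_ker, mem_vanishing]
    simp only [mem_pointIdeal_pow_iff]
    exact ⟨fun h a ha j hj => congrFun h (⟨a, ha⟩, ⟨j, mem_exponentsBelow.2 hj⟩),
      fun h => by
        funext x
        exact h x.1.1 x.1.2 x.2.1 (mem_exponentsBelow.1 x.2.2)⟩
  have h := Submodule.finrank_map_add_finrank_inf_ker f (degreeBelow L n D)
  rw [hf, finrank_degreeBelow] at h
  have h2 : Module.finrank L ((degreeBelow L n D).map f) ≤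
      Z.card * (exponentsBelow n m).card := by
    refine (Submodule.finrank_le _).trans ?_
    simp
  omega

/-- Passing to leading forms does not increase the dimension. -/
theorem finrank_inf_le_of_homogeneousComponent_mem {L : Type*} [Field L] {n D : ℕ}
    {I W : Submodule L (MvPolynomial (Fin n) L)}
    (h : ∀ d < D, ∀ P ∈ I, P.totalDegree ≤ d → homogeneousComponent d P ∈ W) :
    Module.finrank L (degreeBelow L n D ⊓ I : Submodule L _) ≤
      Module.finrank L (degreeBelow L n D ⊓ W : Submodule L _) := by
  have mono : ∀ D, degreeBelow L n D ≤ degreeBelow L n (D + 1) := fun D P hP =>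
    mem_degreeBelow.2 fun j hj => (mem_degreeBelow.1 hP j hj).trans (Nat.lt_succ_self D)
  induction D with
  | zero =>
    have : degreeBelow L n 0 = ⊥ := by
      rw [eq_bot_iff]
      intro P hP
      by_contra hP0
      obtain ⟨j, hj⟩ := support_nonempty.2 hP0
      exact absurd (mem_degreeBelow.1 hP j hj) (Nat.not_lt_zero _)
    rw [this, bot_inf_eq, bot_inf_eq]
  | succ D ih =>
    have ih := ih fun d hd => h d (by omega)
    set V := degreeBelow L n (D + 1) ⊓ I with hV
    have hfin : ∀ U : Submodule L (MvPolynomial (Fin n) L),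
        FiniteDimensional L (degreeBelow L n (D + 1) ⊓ U : Submodule L _) := fun U =>
      Submodule.finiteDimensional_of_le inf_le_left
    have hfin' : ∀ U : Submodule L (MvPolynomial (Fin n) L),
        FiniteDimensional L (degreeBelow L n D ⊓ U : Submodule L _) := fun U =>
      Submodule.finiteDimensional_of_le inf_le_left
    have hVf : FiniteDimensional L V := hfin I
    set f : MvPolynomial (Fin n) L →ₗ[L] MvPolynomial (Fin n) L := homogeneousComponent D
    -- Rank–nullity for the degree `D` part: the image consists of forms in `W`, the kernel falls
    -- under the induction hypothesis, and the two bounds add because forms of degree `D` meet lower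
    -- degrees trivially.
    have h1 := Submodule.finrank_map_add_finrank_inf_ker f V
    have h2 : V.map f ≤ degreeBelow L n (D + 1) ⊓ (homogeneousSubmodule (Fin n) L D ⊓ W) := by
      rintro _ ⟨P, hP, rfl⟩
      refine ⟨mem_degreeBelow_succ.2 ?_, homogeneousComponent_mem _ _,
        h D (Nat.lt_succ_self D) P hP.2 (mem_degreeBelow_succ.1 hP.1)⟩
      exact (homogeneousComponent_isHomogeneous D P).totalDegree_le
    have h3 : V ⊓ LinearMap.ker f ≤ degreeBelow L n D ⊓ I := by
      rintro P ⟨⟨hP, hPI⟩, hP0⟩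
      refine ⟨mem_degreeBelow.2 fun j hj => lt_of_le_of_ne
        (Nat.lt_succ_iff.1 (mem_degreeBelow.1 hP j hj)) fun hjD => ?_, hPI⟩
      have h4 : coeff j (homogeneousComponent D P) = 0 := by
        rw [show homogeneousComponent D P = 0 from hP0, coeff_zero]
      rw [coeff_homogeneousComponent, if_pos hjD] at h4
      exact mem_support_iff.1 hj h4
    have h5 := Submodule.finrank_mono h3
    have h6 := Submodule.finrank_mono h2
    set H := degreeBelow L n (D + 1) ⊓ (homogeneousSubmodule (Fin n) L D ⊓ W)
    have h7 := Submodule.finrank_sup_add_finrank_inf_eq H (degreeBelow L n D ⊓ W)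
    have h8 : H ⊓ (degreeBelow L n D ⊓ W) = ⊥ := by
      rw [eq_bot_iff]
      rintro P ⟨⟨_, hP, _⟩, hP', _⟩
      by_contra hP0
      obtain ⟨j, hj⟩ := support_nonempty.2 hP0
      have h9 := mem_degreeBelow.1 hP' j hj
      exact mem_support_iff.1 hj
        (((mem_homogeneousSubmodule _ _).1 hP).coeff_eq_zero h9.ne)
    have h9 : H ⊔ (degreeBelow L n D ⊓ W) ≤ degreeBelow L n (D + 1) ⊓ W :=
      sup_le (inf_le_inf_left _ inf_le_right) (inf_le_inf_right _ (mono D))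
    have h10 := Submodule.finrank_mono h9
    rw [h8, finrank_bot] at h7
    omega

end MvPolynomial

/-! ### Submodularity of codimension and averaging over a group. -/

section Submodular

variable {K M X : Type*} [Field K] [AddCommGroup M] [Module K M]

/-- Submodularity of the codimension. -/
theorem Submodule.finrank_add_finrank_inf_le {A B W : Submodule K M} [FiniteDimensional K A]
    (hBA : B ≤ A) :
    Module.finrank K B + Module.finrank K (A ⊓ W : Submodule K M) ≤
      Module.finrank K A + Module.finrank K (B ⊓ W : Submodule K M) := by
  have : FiniteDimensional K B := Submodule.finiteDimensional_of_le hBA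
  have h1 := Submodule.finrank_map_add_finrank_inf_ker W.mkQ A
  have h2 := Submodule.finrank_map_add_finrank_inf_ker W.mkQ B
  have h3 := Submodule.finrank_mono (Submodule.map_mono (f := W.mkQ) hBA)
  rw [Submodule.ker_mkQ] at h1 h2
  omega

/-- Greedy weights: each new element gets the drop in dimension it causes. By submodularity the drop
can only be larger when fewer conditions were imposed before, which gives the inequality for
subsets. -/
theorem exists_codim_weights [DecidableEq X] (V : Submodule K M) [FiniteDimensional K V]
    (W : X → Submodule K M) (T : Finset X) : ∃ c : X → ℕ,
      (∀ Z ⊆ T, ∑ x ∈ Z, c x + Module.finrank K (V ⊓ ⨅ x ∈ Z, W x : Submodule K M) ≤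
        Module.finrank K V) ∧
      ∑ x ∈ T, c x + Module.finrank K (V ⊓ ⨅ x ∈ T, W x : Submodule K M) =
        Module.finrank K V := by
  induction T using Finset.induction_on with
  | empty =>
    have h : V ⊓ ⨅ x ∈ (∅ : Finset X), W x = V := by simp
    refine ⟨0, fun Z hZ => ?_, ?_⟩
    · rw [Finset.subset_empty.1 hZ, h]
      simp
    · rw [h]
      simp
  | insert y T hy ih =>
    obtain ⟨c, hc, hcT⟩ := ih
    set U : Finset X → Submodule K M := fun Z => V ⊓ ⨅ x ∈ Z, W x with hU
    have hUfin : ∀ Z, FiniteDimensional K (U Z) := fun Z =>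
      Submodule.finiteDimensional_of_le inf_le_left
    have hins : ∀ Z, U (insert y Z) = U Z ⊓ W y := fun Z => by
      simp only [hU, Finset.iInf_insert]
      rw [inf_comm (W y), inf_assoc]
    have hanti : ∀ {Z Z' : Finset X}, Z ⊆ Z' → U Z' ≤ U Z := fun h =>
      inf_le_inf_left _ (biInf_mono fun x hx => h hx)
    let δ := Module.finrank K (U T) - Module.finrank K (U T ⊓ W y : Submodule K M)
    have hle : Module.finrank K (U T ⊓ W y : Submodule K M) ≤ Module.finrank K (U T) :=
      Submodule.finrank_mono inf_le_left
    have hsum : ∀ Z : Finset X, y ∉ Z → ∑ x ∈ Z, Function.update c y δ x = ∑ x ∈ Z, c x :=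
      fun Z hZ => Finset.sum_congr rfl fun x hx =>
        Function.update_of_ne (ne_of_mem_of_not_mem hx hZ) _ _
    refine ⟨Function.update c y δ, fun Z hZ => ?_, ?_⟩
    · by_cases hyZ : y ∈ Z
      · obtain ⟨Z', hy', rfl⟩ : ∃ Z', y ∉ Z' ∧ insert y Z' = Z :=
          ⟨Z.erase y, Finset.notMem_erase _ _, Finset.insert_erase hyZ⟩
        have hZ' : Z' ⊆ T := fun x hx =>
          (Finset.mem_insert.1 (hZ (Finset.mem_insert_of_mem hx))).resolve_left
            fun h => hy' (h ▸ hx)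
        have h1 := hc Z' hZ'
        have h2 := Submodule.finrank_add_finrank_inf_le (W := W y) (hanti hZ')
        rw [Finset.sum_insert hy', hsum _ hy', Function.update_self]
        change _ + Module.finrank K (U (insert y Z')) ≤ _
        change _ + Module.finrank K (U Z') ≤ _ at h1
        rw [hins]
        omega
      · rw [hsum _ hyZ]
        exact hc Z ((Finset.subset_insert_iff_of_notMem hyZ).1 hZ)
    · rw [Finset.sum_insert hy, hsum _ hy, Function.update_self]
      change _ + Module.finrank K (U (insert y T)) = _
      change _ + Module.finrank K (U T) = _ at hcT
      rw [hins]
      omega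

/-- If a finite group acts transitively on a family of subspaces with zero intersection, compatibly
with dimensions of intersections, then a subfamily of density `β` has an intersection of
codimension at least `β dim V`. -/
theorem card_mul_finrank_add_le {G : Type*} [Group G] [Finite G] [Fintype X] [DecidableEq X]
    [MulAction G X] [MulAction.IsPretransitive G X] (V : Submodule K M) [FiniteDimensional K V]
    (W : X → Submodule K M) (hW : V ⊓ ⨅ x, W x = ⊥)
    (hG : ∀ (g : G) (Z : Finset X),
      Module.finrank K (V ⊓ ⨅ x ∈ Z, W x : Submodule K M) ≤
        Module.finrank K (V ⊓ ⨅ x ∈ Z.image (g • ·), W x : Submodule K M))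
    (Z : Finset X) :
    Z.card * Module.finrank K V +
        Fintype.card X * Module.finrank K (V ⊓ ⨅ x ∈ Z, W x : Submodule K M) ≤
      Fintype.card X * Module.finrank K V := by
  cases nonempty_fintype G
  obtain ⟨c, hc, hcT⟩ := exists_codim_weights V W Finset.univ
  have hW' : V ⊓ ⨅ x ∈ (Finset.univ : Finset X), W x = ⊥ := by simpa using hW
  rw [hW', finrank_bot, add_zero] at hcT
  set u := Module.finrank K (V ⊓ ⨅ x ∈ Z, W x : Submodule K M)
  -- Transitivity makes the averaged weight constant on `X`, so `Z` gets on average its proportional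
  -- share of `dim V`; each translate of `Z` has codimension at most that of `Z`.
  have hconst : ∀ x y : X, ∑ g : G, c (g • x) = ∑ g : G, c (g • y) := by
    intro x y
    obtain ⟨h, rfl⟩ := MulAction.exists_smul_eq G x y
    rw [← Equiv.sum_comp (Equiv.mulRight h) fun g => c (g • x)]
    simp [mul_smul]
  have h1 : ∀ x : X, Fintype.card X * ∑ g : G, c (g • x) =
      Fintype.card G * Module.finrank K V := by
    intro x
    calc Fintype.card X * ∑ g : G, c (g • x) = ∑ y : X, ∑ g : G, c (g • y) := by
          rw [Finset.sum_congr rfl fun y _ => hconst y x]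
          simp
      _ = ∑ g : G, ∑ y : X, c (g • y) := Finset.sum_comm
      _ = ∑ _g : G, Module.finrank K V := by
          refine Finset.sum_congr rfl fun g _ => ?_
          rw [← hcT]
          exact Equiv.sum_comp (MulAction.toPerm g) c
      _ = _ := by simp
  have h2 : ∀ g : G, ∑ x ∈ Z, c (g • x) + u ≤ Module.finrank K V := by
    intro g
    have := hc (Z.image (g • ·)) (Finset.subset_univ _)
    rw [Finset.sum_image fun x _ y _ h => MulAction.injective g h] at this
    exact (Nat.add_le_add_left (hG g Z) _).trans this
  have h3 := Finset.sum_le_sum fun g (_ : g ∈ (Finset.univ : Finset G)) => h2 g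
  rw [Finset.sum_add_distrib, Finset.sum_comm] at h3
  simp only [Finset.sum_const, Finset.card_univ, smul_eq_mul] at h3
  have h4 : Fintype.card X * ∑ x ∈ Z, ∑ g : G, c (g • x) =
      Z.card * (Fintype.card G * Module.finrank K V) := by
    rw [Finset.mul_sum, Finset.sum_congr rfl fun x _ => h1 x]
    simp
  have h5 := Nat.mul_le_mul_left (Fintype.card X) h3
  rw [mul_add, h4] at h5
  refine Nat.le_of_mul_le_mul_left (c := Fintype.card G) ?_ Fintype.card_pos
  calc _ = Z.card * (Fintype.card G * Module.finrank K V) +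
        Fintype.card X * (Fintype.card G * u) := by ring
    _ ≤ _ := h5
    _ = _ := by ring

end Submodular

/-! ### The transitive linear action on directions. -/

section Grassmannian

variable {F : Type*} [Field F]

theorem Submodule.exists_le_finrank_eq {E : Type*} [AddCommGroup E] [Module F E]
    [FiniteDimensional F E] (B : Submodule F E) {k : ℕ} (hB : Module.finrank F B ≤ k)
    (hk : k ≤ Module.finrank F E) : ∃ A : Submodule F E, B ≤ A ∧ Module.finrank F A = k := by
  induction k, hB using Nat.le_induction with
  | base => exact ⟨B, le_rfl, rfl⟩
  | succ k _ ih =>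
    obtain ⟨A, hBA, hA⟩ := ih (by omega)
    obtain ⟨v, -, hv⟩ := SetLike.exists_of_lt (show A < ⊤ from lt_top_iff_ne_top.2 fun h => by
      rw [h, finrank_top] at hA
      omega)
    refine ⟨A ⊔ F ∙ v, hBA.trans le_sup_left, ?_⟩
    rw [Submodule.finrank_sup_span_singleton hv, hA]

theorem Submodule.exists_linearEquiv_map_eq {E : Type*} [AddCommGroup E] [Module F E]
    [FiniteDimensional F E] {A B : Submodule F E}
    (h : Module.finrank F A = Module.finrank F B) :
    ∃ g : E ≃ₗ[F] E, A.map (g : E →ₗ[F] E) = B := by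
  obtain ⟨A', hA'⟩ := A.exists_isCompl
  obtain ⟨B', hB'⟩ := B.exists_isCompl
  have h1 := Submodule.finrank_add_eq_of_isCompl hA'
  have h2 := Submodule.finrank_add_eq_of_isCompl hB'
  let e : A ≃ₗ[F] B := LinearEquiv.ofFinrankEq _ _ h
  let e' : A' ≃ₗ[F] B' := LinearEquiv.ofFinrankEq _ _ (by omega)
  let g : E ≃ₗ[F] E := (Submodule.prodEquivOfIsCompl A A' hA').symm ≪≫ₗ
    (e.prodCongr e') ≪≫ₗ Submodule.prodEquivOfIsCompl B B' hB'
  refine ⟨g, Submodule.eq_of_le_of_finrank_eq ?_ ?_⟩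
  · rintro _ ⟨x, hx, rfl⟩
    have : g x = e ⟨x, hx⟩ := by
      have h3 := Submodule.prodEquivOfIsCompl_symm_apply_left A A' hA' ⟨x, hx⟩
      simp only [g, LinearEquiv.trans_apply]
      rw [h3]
      simp
    rw [LinearEquiv.coe_coe, this]
    exact (e ⟨x, hx⟩).2
  · rw [LinearEquiv.finrank_map_eq, h]

instance (n k : ℕ) : MulAction ((Fin n → F) ≃ₗ[F] (Fin n → F)) (directions F n k) where
  smul g A := ⟨A.1.map (g : (Fin n → F) →ₗ[F] (Fin n → F)),
    (LinearEquiv.finrank_map_eq g A.1).trans A.2⟩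
  one_smul _ := Subtype.ext (Submodule.map_id _)
  mul_smul _ _ _ := Subtype.ext (Submodule.map_comp _ _ _)

instance (n k : ℕ) :
    MulAction.IsPretransitive ((Fin n → F) ≃ₗ[F] (Fin n → F)) (directions F n k) where
  exists_smul_eq A B := by
    obtain ⟨g, hg⟩ := Submodule.exists_linearEquiv_map_eq (A.2.trans B.2.symm)
    exact ⟨g, Subtype.ext hg⟩

end Grassmannian

/-! ### Extending directions to the larger field. -/

section Extension

variable {F L : Type*} [Field F] [Field L] [Algebra F L] {n k : ℕ}

/-- The point `∑ t, ω t • v t` of `L ^ n` with `v t` in `F ^ n`. -/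
def extendedPoint (ω : Fin k → L) (v : Fin k → Fin n → F) : Fin n → L :=
  fun i => ∑ t, ω t * algebraMap F L (v t i)

/-- The points of the extension of `A` to `L`. -/
def extendedPoints (ω : Fin k → L) (A : Submodule F (Fin n → F)) : Set (Fin n → L) :=
  {x | ∃ v : Fin k → Fin n → F, (∀ t, v t ∈ A) ∧ extendedPoint ω v = x}

/-- The `ω`-coordinates of `x` are `k` vectors of `F ^ n`; any `k`-dimensional subspace containing
them works. -/
theorem exists_mem_extendedPoints (ω : Module.Basis (Fin k) F L) (hkn : k ≤ n) (x : Fin n → L) :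
    ∃ A : directions F n k, x ∈ extendedPoints ω A.1 := by
  let v : Fin k → Fin n → F := fun t i => ω.repr (x i) t
  obtain ⟨A, hA, hAk⟩ := (Submodule.span F (Set.range v)).exists_le_finrank_eq (k := k)
    ((finrank_range_le_card (R := F) v).trans_eq (Fintype.card_fin k)) (by simpa using hkn)
  refine ⟨⟨A, hAk⟩, v, fun t => hA (Submodule.subset_span ⟨t, rfl⟩), funext fun i => ?_⟩
  conv_rhs => rw [← ω.sum_repr (x i)]
  exact Finset.sum_congr rfl fun t _ => by rw [Algebra.smul_def, mul_comm]

open MvPolynomial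

theorem MvPolynomial.totalDegree_bind₁_toMvPolynomial_le (M : Matrix (Fin n) (Fin n) L)
    (P : MvPolynomial (Fin n) L) :
    (bind₁ M.toMvPolynomial P).totalDegree ≤ P.totalDegree := by
  conv_lhs => rw [P.as_sum, map_sum]
  refine totalDegree_finsetSum_le fun m hm => ?_
  rw [bind₁_monomial]
  refine (totalDegree_mul _ _).trans ?_
  rw [totalDegree_C, zero_add]
  refine (totalDegree_finsetProd _ _).trans (le_trans ?_ (le_totalDegree hm))
  refine Finset.sum_le_sum fun i _ => (totalDegree_pow _ _).trans ?_
  exact (Nat.mul_le_mul_left _ (M.toMvPolynomial_totalDegree_le i)).trans (mul_one _).le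

theorem MvPolynomial.bind₁_toMvPolynomial_injective {M N : Matrix (Fin n) (Fin n) L}
    (h : M * N = 1) : Function.Injective (bind₁ M.toMvPolynomial) := by
  refine Function.HasLeftInverse.injective ⟨bind₁ N.toMvPolynomial, fun P => ?_⟩
  rw [bind₁_bind₁]
  have : (fun i => bind₁ N.toMvPolynomial (M.toMvPolynomial i)) = X := by
    funext i
    rw [← Matrix.toMvPolynomial_mul, h, Matrix.toMvPolynomial_one]
  rw [this]
  simp

theorem MvPolynomial.bind₁_toMvPolynomial_mem {M : Matrix (Fin n) (Fin n) L} {y : Fin n → L}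
    {w : ℕ} {P : MvPolynomial (Fin n) L} (hP : P ∈ pointIdeal (M.mulVec y) ^ w) :
    bind₁ M.toMvPolynomial P ∈ pointIdeal y ^ w := by
  refine map_mem_pow_of_mem_pointIdeal_pow (bind₁ M.toMvPolynomial).toRingHom (fun i => ?_) hP
  have h1 : (∑ j, C (M i j) * (X j - C (y j))) ∈ pointIdeal y :=
    Ideal.sum_mem _ fun j _ => Ideal.mul_mem_left _ _ (Ideal.subset_span ⟨j, rfl⟩)
  convert h1 using 1
  simp [Matrix.toMvPolynomial, Matrix.mulVec, dotProduct, ← C_mul_X_eq_monomial, mul_sub]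

theorem mulVec_extendedPoint (ω : Fin k → L) (g : (Fin n → F) →ₗ[F] (Fin n → F))
    (v : Fin k → Fin n → F) :
    ((LinearMap.toMatrix' g).map (algebraMap F L)).mulVec (extendedPoint ω v) =
      extendedPoint ω fun t => g (v t) := by
  funext i
  have h : ∀ t, g (v t) i = ∑ j, LinearMap.toMatrix' g i j * v t j := fun t => by
    conv_lhs => rw [← Matrix.toLin'_toMatrix' g, Matrix.toLin'_apply]
    rfl
  simp only [Matrix.mulVec, dotProduct, extendedPoint, h, map_sum, map_mul, Finset.mul_sum,
    Matrix.map_apply]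
  rw [Finset.sum_comm]
  exact Finset.sum_congr rfl fun t _ => Finset.sum_congr rfl fun j _ => by ring

/-- Composition with the inverse of `g`, extended to `L`, is injective, does not raise degrees, and
carries vanishing along `A` to vanishing along `g • A`. -/
theorem finrank_le_finrank_image_smul [DecidableEq (directions F n k)] (ω : Fin k → L)
    (d w : ℕ) (g : (Fin n → F) ≃ₗ[F] (Fin n → F)) (Z : Finset (directions F n k)) :
    Module.finrank L (degreeBelow L n (d + 1) ⊓
        ⨅ A ∈ Z, vanishing (extendedPoints ω A.1) w : Submodule L _) ≤
      Module.finrank L (degreeBelow L n (d + 1) ⊓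
        ⨅ A ∈ Z.image (g • ·), vanishing (extendedPoints ω A.1) w : Submodule L _) := by
  set M := (LinearMap.toMatrix' (g.symm : (Fin n → F) →ₗ[F] (Fin n → F))).map (algebraMap F L)
  set N := (LinearMap.toMatrix' (g : (Fin n → F) →ₗ[F] (Fin n → F))).map (algebraMap F L)
  have hMN : M * N = 1 := by
    simp only [M, N]
    rw [← Matrix.map_mul, ← LinearMap.toMatrix'_comp, ← LinearEquiv.coe_trans,
      LinearEquiv.self_trans_symm]
    simp
  have hinj := bind₁_toMvPolynomial_injective hMN
  rw [(Submodule.equivMapOfInjective (bind₁ M.toMvPolynomial).toLinearMap hinj _).finrank_eq]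
  have : FiniteDimensional L (degreeBelow L n (d + 1) ⊓
        ⨅ A ∈ Z.image (g • ·), vanishing (extendedPoints ω A.1) w : Submodule L _) :=
    Submodule.finiteDimensional_of_le inf_le_left
  refine Submodule.finrank_mono ?_
  rintro _ ⟨P, ⟨hP, hPZ⟩, rfl⟩
  refine ⟨mem_degreeBelow_succ.2 ((totalDegree_bind₁_toMvPolynomial_le M P).trans
    (mem_degreeBelow_succ.1 hP)), ?_⟩
  simp only [SetLike.mem_coe, Submodule.mem_iInf, mem_vanishing] at hPZ ⊢
  intro B hB y hy
  obtain ⟨A, hA, rfl⟩ := Finset.mem_image.1 hB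
  obtain ⟨v, hv, rfl⟩ := hy
  refine bind₁_toMvPolynomial_mem ?_
  rw [mulVec_extendedPoint]
  refine hPZ A hA _ ⟨_, fun t => ?_, rfl⟩
  obtain ⟨x, hx, hxv⟩ := hv t
  rw [← hxv]
  simpa using hx

theorem degreeBelow_inf_iInf_vanishing_eq_bot [Fintype L] (ω : Module.Basis (Fin k) F L)
    (hkn : k ≤ n) {d w : ℕ} (hd : d < Fintype.card L * w) :
    degreeBelow L n (d + 1) ⊓
      ⨅ A : directions F n k, vanishing (extendedPoints ω A.1) w = ⊥ := by
  classical
  rw [eq_bot_iff]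
  rintro P ⟨hP, hPA⟩
  simp only [SetLike.mem_coe, Submodule.mem_iInf, mem_vanishing] at hPA
  rw [Submodule.mem_bot]
  refine eq_zero_of_mem_pointIdeal_pow Finset.univ (mem_degreeBelow_succ.1 hP)
    (Finset.univ : Finset (Fin n → L)) (w := w) (by simp) (fun x _ => ?_) ?_
  · obtain ⟨A, hA⟩ := exists_mem_extendedPoints ω hkn x
    exact hPA A x hA
  · have : 0 < Fintype.card L ^ n := pow_pos Fintype.card_pos n
    simp only [Finset.card_univ, Fintype.card_pi, Finset.prod_const, Fintype.card_fin]
    calc d * Fintype.card L ^ n < (Fintype.card L * w) * Fintype.card L ^ n :=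
          Nat.mul_lt_mul_of_pos_right hd this
      _ = _ := by ring

theorem homogeneousComponent_mem_vanishing_extendedPoints [Fintype F] (ω : Fin k → L)
    {K : Finset (Fin n → F)} {A : directions F n k} {a : Fin n → F} {s d m w : ℕ}
    (hs : s ≤ ((a +ᵥ (A.1 : Set (Fin n → F))) ∩ K : Set (Fin n → F)).ncard)
    (h : d * Fintype.card F ^ k < Fintype.card F * (s * (m - w)))
    {P : MvPolynomial (Fin n) L} (hd : P.totalDegree ≤ d)
    (hP : P ∈ vanishing ((fun x i => algebraMap F L (x i)) '' (K : Set (Fin n → F))) m) :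
    homogeneousComponent d P ∈ vanishing (extendedPoints ω A.1) w := by
  classical
  let e := Module.finBasisOfFinrankEq F A.1 A.2
  let b : Fin k → Fin n → F := fun t => (e t : Fin n → F)
  have hb : ∀ x ∈ A.1, ∃ u : Fin k → F, x = ∑ t, u t • b t := fun x hx =>
    ⟨fun t => e.repr ⟨x, hx⟩ t, by
      have := congrArg A.1.subtype (e.sum_repr ⟨x, hx⟩)
      rw [map_sum] at this
      exact this.symm⟩
  let T₀ : Finset (Fin k → F) := Finset.univ.filter fun u => a + ∑ t, u t • b t ∈ K
  have hT₀ : s ≤ T₀.card := by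
    refine hs.trans ?_
    have hsub : ((a +ᵥ (A.1 : Set (Fin n → F))) ∩ K : Set (Fin n → F)) ⊆
        (T₀.image fun u => a + ∑ t, u t • b t : Finset (Fin n → F)) := by
      rintro _ ⟨⟨x, hx, rfl⟩, hK⟩
      obtain ⟨u, rfl⟩ := hb x hx
      exact Finset.mem_coe.2 (Finset.mem_image.2
        ⟨u, Finset.mem_filter.2 ⟨Finset.mem_univ _, hK⟩, rfl⟩)
    refine (Set.ncard_le_ncard hsub (Finset.finite_toSet _)).trans ?_
    rw [Set.ncard_coe_finset]
    exact Finset.card_image_le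
  have hinj : Function.Injective (algebraMap F L) := (algebraMap F L).injective
  -- The grid is the copy of `F ^ k` in `L ^ k`, so its side is `q`; the conclusion still holds for
  -- all parameters in `L ^ k`.
  let S : Finset L := Finset.univ.image (algebraMap F L)
  have hS : S.card = Fintype.card F := Finset.card_image_of_injective _ hinj
  let T : Finset (Fin k → L) := T₀.image fun u t => algebraMap F L (u t)
  have hT : T.card = T₀.card := Finset.card_image_of_injective _ hinj.comp_left
  have key := homogeneousComponent_mem_pointIdeal_pow (a := fun i => algebraMap F L (a i))
    (b := fun t i => algebraMap F L (b t i)) (m := m) (w := w) hd S T ?_ ?_ ?_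
  · rw [mem_vanishing]
    rintro _ ⟨v, hv, rfl⟩
    choose u hu using fun t => hb (v t) (hv t)
    convert key fun r => ∑ t, ω t * algebraMap F L (u t r) using 2
    congr 1
    funext i
    simp only [extendedPoint, hu, Finset.sum_apply, Pi.smul_apply, smul_eq_mul, map_sum, map_mul,
      Finset.mul_sum, Finset.sum_mul]
    rw [Finset.sum_comm]
    exact Finset.sum_congr rfl fun t _ => Finset.sum_congr rfl fun j _ => by ring
  · intro p hp
    obtain ⟨u, -, rfl⟩ := Finset.mem_image.1 hp
    rw [Fintype.mem_piFinset]
    exact fun t => Finset.mem_image_of_mem _ (Finset.mem_univ _)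
  · intro p hp
    obtain ⟨u, hu, rfl⟩ := Finset.mem_image.1 hp
    have := mem_vanishing.1 hP _ ⟨_, (Finset.mem_filter.1 hu).2, rfl⟩
    convert this using 3
    simp
  · rw [hS, hT]
    exact h.trans_le (by gcongr)

/-- The counting inequality behind the lower bound for Furstenberg sets. -/
theorem card_mul_card_exponentsBelow_le [Fintype F] [Fintype L] [Fintype (directions F n k)]
    (ω : Module.Basis (Fin k) F L) (hkn : k ≤ n) {K : Finset (Fin n → F)}
    {Z : Finset (directions F n k)} {s d m w : ℕ}
    (hZ : ∀ A ∈ Z, ∃ a : Fin n → F,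
      s ≤ ((a +ᵥ (A.1 : Set (Fin n → F))) ∩ K : Set (Fin n → F)).ncard)
    (h1 : d < Fintype.card L * w)
    (h2 : d * Fintype.card F ^ k < Fintype.card F * (s * (m - w))) :
    Z.card * (exponentsBelow n (d + 1)).card ≤
      Fintype.card (directions F n k) * (K.card * (exponentsBelow n m).card) := by
  classical
  let K' : Finset (Fin n → L) := K.image fun x i => algebraMap F L (x i)
  have hK' : K'.card ≤ K.card := Finset.card_image_le
  have hK'c : (K' : Set (Fin n → L)) =
      (fun (x : Fin n → F) i => algebraMap F L (x i)) '' (K : Set (Fin n → F)) := by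
    simp [K']
  have h3 := finrank_degreeBelow_le K' m (d + 1)
  have h4 := finrank_inf_le_of_homogeneousComponent_mem (D := d + 1)
    (I := vanishing (K' : Set (Fin n → L)) m)
    (W := ⨅ A ∈ Z, vanishing (extendedPoints (ω : Fin k → L) A.1) w) fun e he P hP heP => by
      simp only [Submodule.mem_iInf]
      intro A hA
      obtain ⟨a, ha⟩ := hZ A hA
      rw [hK'c] at hP
      refine homogeneousComponent_mem_vanishing_extendedPoints ω ha (lt_of_le_of_lt ?_ h2) heP hP
      exact Nat.mul_le_mul_right _ (Nat.lt_succ_iff.1 he)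
  have : Finite ((Fin n → F) ≃ₗ[F] (Fin n → F)) := DFunLike.finite _
  have h5 := card_mul_finrank_add_le (G := (Fin n → F) ≃ₗ[F] (Fin n → F))
    (degreeBelow L n (d + 1)) (fun A : directions F n k => vanishing (extendedPoints ω A.1) w)
    (degreeBelow_inf_iInf_vanishing_eq_bot ω hkn h1)
    (fun g Z => finrank_le_finrank_image_smul ω d w g Z) Z
  rw [finrank_degreeBelow] at h5
  have h6 := Nat.mul_le_mul_left (Fintype.card (directions F n k))
    ((h3.trans (Nat.add_le_add_right h4 _)).trans
      (Nat.add_le_add_left (Nat.mul_le_mul_right _ hK') _))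
  rw [mul_add] at h6
  omega

end Extension

/-! ### Choice of parameters and the limit. -/

open Filter Topology in
theorem le_mul_pow_of_forall_le {β κ c b : ℝ} (n : ℕ)
    (h : ∀ d : ℕ, β * ((d : ℝ) + 1) ^ n ≤ κ * (c * ((d : ℝ) + 1) + b) ^ n) :
    β ≤ κ * c ^ n := by
  have h1 : Tendsto (fun d : ℕ => κ * (c + b * (1 / ((d : ℝ) + 1))) ^ n) atTop
      (𝓝 (κ * (c + b * 0) ^ n)) :=
    ((tendsto_one_div_add_atTop_nhds_zero_nat.const_mul b).const_add c).pow n |>.const_mul κ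
  rw [mul_zero, add_zero] at h1
  refine ge_of_tendsto' h1 fun d => ?_
  have hd : (0 : ℝ) < (d : ℝ) + 1 := by positivity
  refine le_of_mul_le_mul_right ((h d).trans_eq ?_) (pow_pos hd n)
  rw [mul_assoc, ← mul_pow]
  congr 2
  field_simp

theorem card_directions_pos {F : Type*} [Field F] {n k : ℕ} [Fintype (directions F n k)]
    (hkn : k ≤ n) : 0 < Fintype.card (directions F n k) := by
  obtain ⟨A, -, hA⟩ := (⊥ : Submodule F (Fin n → F)).exists_le_finrank_eq (k := k) (by simp)
    (by simpa using hkn)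
  exact Fintype.card_pos_iff.2 ⟨⟨A, hA⟩⟩

theorem IsFurstenberg.le_mul_pow {F : Type*} [Field F] [Fintype F] {n k : ℕ} (hk : 1 ≤ k)
    (hkn : k ≤ n) {γ β : ℝ} (hγ : 0 < γ) {K : Set (Fin n → F)}
    (hK : IsFurstenberg k (γ * (Fintype.card F : ℝ) ^ k) β K) :
    β ≤ K.ncard * (1 / (Fintype.card F : ℝ) ^ k + 1 / (γ * Fintype.card F)) ^ n := by
  classical
  obtain ⟨p, hp⟩ := CharP.exists F
  have : Fact p.Prime := ⟨CharP.char_is_prime F p⟩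
  have : NeZero k := ⟨by omega⟩
  let L := FiniteField.Extension F p k
  cases nonempty_fintype L
  cases nonempty_fintype (directions F n k)
  let ω : Module.Basis (Fin k) F L :=
    Module.finBasisOfFinrankEq F L (FiniteField.finrank_extension F p k)
  have hL : Fintype.card L = Fintype.card F ^ k := by
    rw [← Nat.card_eq_fintype_card, ← Nat.card_eq_fintype_card]
    exact FiniteField.natCard_extension F p k
  set q := Fintype.card F
  have hq0 : 0 < q := Fintype.card_pos
  have hqR : (0 : ℝ) < q := by exact_mod_cast hq0
  obtain ⟨K, rfl⟩ : ∃ K' : Finset (Fin n → F), (K' : Set (Fin n → F)) = K :=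
    ⟨K.toFinite.toFinset, by simp⟩
  rw [Set.ncard_coe_finset]
  let Z : Finset (directions F n k) := Finset.univ.filter fun A =>
    ∃ a : Fin n → F, IsRich (γ * (q : ℝ) ^ k) (a +ᵥ (A.1 : Set (Fin n → F))) (K : Set _)
  have hGr : ((directions F n k).ncard : ℝ) = Fintype.card (directions F n k) := by
    rw [← Nat.card_coe_set_eq, Nat.card_eq_fintype_card]
  have hZcard : {A ∈ directions F n k | ∃ a : Fin n → F,
      IsRich (γ * (q : ℝ) ^ k) (a +ᵥ (A : Set (Fin n → F))) (K : Set _)}.ncard = Z.card := by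
    rw [← Set.ncard_coe_finset, ← Set.ncard_image_of_injective _ Subtype.val_injective]
    congr 1
    ext A
    simp [Z, and_comm]
  rw [IsFurstenberg, hZcard, hGr] at hK
  have hGrpos : (0 : ℝ) < Fintype.card (directions F n k) := by
    exact_mod_cast card_directions_pos hkn
  refine le_mul_pow_of_forall_le (b := n + 1) n fun d => ?_
  -- `w` and `t` are the least integers with `d < q ^ k * w` and `d < γ * q * t`; the multiplicity
  -- imposed on `K` is `w + t`.
  let w := d / q ^ k + 1
  let t := ⌊(d : ℝ) / (γ * q)⌋₊ + 1
  let s := ⌈γ * (q : ℝ) ^ k⌉₊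
  have hZ : ∀ A ∈ Z, ∃ a : Fin n → F,
      s ≤ ((a +ᵥ (A.1 : Set (Fin n → F))) ∩ K : Set (Fin n → F)).ncard := by
    intro A hA
    obtain ⟨a, ha⟩ := (Finset.mem_filter.1 hA).2
    exact ⟨a, Nat.ceil_le.2 ha⟩
  have h1 : d < Fintype.card L * w := by
    rw [hL]
    exact Nat.lt_mul_div_succ d (pow_pos hq0 k)
  have ht : (d : ℝ) < γ * q * t := by
    have := Nat.lt_floor_add_one ((d : ℝ) / (γ * q))
    rw [div_lt_iff₀ (by positivity)] at this
    simp only [t]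
    push_cast
    linarith
  have h2 : d * q ^ k < q * (s * (w + t - w)) := by
    rw [Nat.add_sub_cancel_left]
    have hs : γ * (q : ℝ) ^ k ≤ s := Nat.le_ceil _
    have : (d : ℝ) * q ^ k < q * (s * t) := by
      calc (d : ℝ) * q ^ k < γ * q * t * q ^ k := by gcongr
        _ = q * (γ * q ^ k * t) := by ring
        _ ≤ q * (s * t) := by gcongr
    exact_mod_cast this
  have h3 := card_mul_card_exponentsBelow_le ω hkn hZ h1 h2
  have h4 : Z.card * (d + 1) ^ n ≤
      Fintype.card (directions F n k) * (K.card * (w + t - 1 + n) ^ n) := by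
    have h5 := Nat.mul_le_mul_left n.factorial h3
    have h6 : w + t = (w + t - 1) + 1 := (Nat.sub_add_cancel (Nat.le_add_left 1 _)).symm
    calc Z.card * (d + 1) ^ n ≤ Z.card * (d + 1).ascFactorial n :=
          Nat.mul_le_mul_left _ (Nat.pow_succ_le_ascFactorial _ _)
      _ = n.factorial * (Z.card * (exponentsBelow n (d + 1)).card) := by
          rw [← factorial_mul_card_exponentsBelow]
          ring
      _ ≤ _ := h5
      _ = Fintype.card (directions F n k) *
          (K.card * (n.factorial * (exponentsBelow n (w + t - 1 + 1)).card)) := by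
          rw [← h6]
          ring
      _ ≤ _ := by
          rw [factorial_mul_card_exponentsBelow]
          gcongr
          exact Nat.ascFactorial_le_pow_add _ _
  have h5 : (((w + t - 1 + n : ℕ)) : ℝ) ≤
      (1 / (q : ℝ) ^ k + 1 / (γ * q)) * ((d : ℝ) + 1) + (n + 1) := by
    have hw : ((d / q ^ k : ℕ) : ℝ) ≤ d / (q : ℝ) ^ k := by
      exact_mod_cast Nat.cast_div_le (α := ℝ) (m := d) (n := q ^ k)
    have ht' : ((⌊(d : ℝ) / (γ * q)⌋₊ : ℕ) : ℝ) ≤ d / (γ * q) :=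
      Nat.floor_le (by positivity)
    have h6 : w + t - 1 + n = d / q ^ k + ⌊(d : ℝ) / (γ * q)⌋₊ + (n + 1) := by
      simp only [w, t]
      generalize d / q ^ k = u
      omega
    rw [h6]
    push_cast
    have h7 : (0 : ℝ) ≤ 1 / (q : ℝ) ^ k + 1 / (γ * q) := by positivity
    calc _ ≤ (d : ℝ) / (q : ℝ) ^ k + d / (γ * q) + (n + 1) := by gcongr
      _ = (1 / (q : ℝ) ^ k + 1 / (γ * q)) * d + (n + 1) := by ring
      _ ≤ _ := by nlinarith
  have h6 : (Z.card : ℝ) * ((d : ℝ) + 1) ^ n ≤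
      Fintype.card (directions F n k) * (K.card * ((w + t - 1 + n : ℕ) : ℝ) ^ n) := by
    exact_mod_cast h4
  refine le_of_mul_le_mul_left ?_ hGrpos
  calc (Fintype.card (directions F n k) : ℝ) * (β * ((d : ℝ) + 1) ^ n)
      = β * Fintype.card (directions F n k) * ((d : ℝ) + 1) ^ n := by ring
    _ ≤ Z.card * ((d : ℝ) + 1) ^ n := by gcongr
    _ ≤ _ := h6
    _ ≤ _ := by gcongr

theorem mainTheorem10 {F : Type*} [Field F] [Fintype F] (n k : ℕ) (hk : 1 ≤ k) (hkn : k ≤ n)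
    (γ β : ℝ) (hγ : γ ∈ Set.Icc (0 : ℝ) 1) (hβ : β ∈ Set.Icc (0 : ℝ) 1)
    (K : Set (Fin n → F))
    (hK : IsFurstenberg k (γ * (Fintype.card F : ℝ) ^ k) β K) :
    (K.ncard : ℝ) ≥ β * γ ^ n * (Fintype.card F : ℝ) ^ n *
      (1 + 1 / (Fintype.card F : ℝ) ^ (k - 1)) ^ (-(n : ℤ)) := by
  rcases hγ.1.eq_or_lt with rfl | hγ0
  · rw [zero_pow (by omega)]
    simp
  have hq : (0 : ℝ) < Fintype.card F := by exact_mod_cast Fintype.card_pos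
  have h := hK.le_mul_pow hk hkn hγ0
  set q : ℝ := (Fintype.card F : ℝ)
  have hr : (0 : ℝ) < 1 + 1 / q ^ (k - 1) := by positivity
  -- Only here is `γ ≤ 1` needed: it weakens the sharper bound to the stated form.
  have hc : 1 / q ^ k + 1 / (γ * q) ≤ (1 + 1 / q ^ (k - 1)) / (γ * q) := by
    have h1 : 1 / q ^ k ≤ (1 / q ^ (k - 1)) / (γ * q) := by
      rw [div_div]
      refine one_div_le_one_div_of_le (by positivity) ?_
      calc q ^ (k - 1) * (γ * q) ≤ q ^ (k - 1) * (1 * q) := by gcongr; exact hγ.2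
        _ = q ^ k := by rw [one_mul, ← pow_succ, Nat.sub_add_cancel hk]
    rw [add_div]
    linarith
  have h2 : β ≤ K.ncard * ((1 + 1 / q ^ (k - 1)) / (γ * q)) ^ n :=
    h.trans (by gcongr)
  rw [ge_iff_le, zpow_neg, zpow_natCast, ← div_eq_mul_inv, div_le_iff₀ (by positivity)]
  rw [div_pow, ← mul_div_assoc, le_div_iff₀ (by positivity), mul_pow] at h2
  linarith
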